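/- Let $\gamma\in\mathbb R$, let $R_\gamma(t)=t-\gamma \pmod 1$ on $\mathbb R/\mathbb Z$, and let $E_\gamma=(\mathbb R/\mathbb Z,\mathbb R/\mathbb Z,\mathrm{id},R_\gamma)$ be the corresponding topological graph. Its Hilbert $C(\mathbb R/\mathbb Z)$-bimodule $X=X(E_\gamma)$ is a copy of $C(\mathbb R/\mathbb Z)$ with actions $(g_1\cdot f\cdot g_2)(z)=g_1(z)f(z)g_2(R_\gamma(z))$ and inner product $\langle f_1,f_2\rangle(z)=\overline{f_1(R_\gamma^{-1}(z))}\,f_2(R_\gamma^{-1}(z))$; write $\varphi$ for the left action by operators on $X$, and $\mathcal K(X)$ for the closed linear span of the operators $\Theta_{f_1,f_2}(f)=f_1\cdot\langle f_2,f\rangle$. A representation of $X$ in a $C^*$-algebra $B$ is a pair $(\psi,\pi)$ of a linear map $\psi:X\to B$ and a $*$-homomorphism $\pi:C(\mathbb R/\mathbb Z)\to B$ with $\psi(f\cdot g)=\psi(f)\pi(g)$, $\psi(f)^*\psi(f')=\pi(\langle f,f'\rangle)$ and $\psi(g\cdot f)=\pi(g)\psi(f)$; it induces a homomorphism $(\psi,\pi)^{(1)}:\mathcal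 K(X)\to B$ with $(\psi,\pi)^{(1)}(\Theta_{f_1,f_2})=\psi(f_1)\psi(f_2)^*$. The Toeplitz algebra $\mathcal T(E_\gamma)$ is the universal $C^*$-algebra generated by a representation $(i^1,i^0)$ of $X$. The graph algebra $\mathcal O(E_\gamma)$ is the quotient of $\mathcal T(E_\gamma)$ by the closed two-sided ideal generated by $\{(i^1,i^0)^{(1)}(\varphi(g))-i^0(g): g\in C(\mathbb R/\mathbb Z)\}$, with quotient map $q$ and $(j^1,j^0)=(q\circ i^1,q\circ i^0)$. Both algebras are unital, with units $i^0(1)$ and $j^0(1)$. A Toeplitz pair for $E_\gamma$ in a unital $C^*$-algebra $B$ is a pair $(\pi,S)$ of a unital $*$-homomorphism $\pi:C(\mathbb R/\mathbb Z)\to B$ and an isometry $S\in B$ with $S\pi(f)=\pi(f\circ R_\gamma)S$ for all $f\in C(\mathbb R/\mathbb Z)$. A covariant pair is a Toeplitz pair $(\pi,W)$ in which $W$ is unitary. Proposition. (1) The pair $(i_\gamma,s_\gamma):=(i^0,i^1(1))$ is a Toeplitz pair for $E_\gamma$ that generates $\mathcal T(E_\gamma)$ as a $C^*$-algebra, and it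 is universal: for every Toeplitz pair $(\pi,S)$ for $E_\gamma$ in a unital $C^*$-algebra $B$ there is a unique unital $*$-homomorphism $\pi\times S:\mathcal T(E_\gamma)\to B$ with $(\pi\times S)\circ i_\gamma=\pi$ and $(\pi\times S)(s_\gamma)=S$. (2) The pair $(j_\gamma,w_\gamma):=(j^0,j^1(1))$ is a covariant pair for $E_\gamma$ that generates $\mathcal O(E_\gamma)$ as a $C^*$-algebra, and it is universal: for every covariant pair $(\pi,W)$ for $E_\gamma$ in a unital $C^*$-algebra $B$ there is a unique unital $*$-homomorphism $\pi\times W:\mathcal O(E_\gamma)\to B$ with $(\pi\times W)\circ j_\gamma=\pi$ and $(\pi\times W)(w_\gamma)=W$. (3) The quotient map $q:\mathcal T(E_\gamma)\to\mathcal O(E_\gamma)$ is surjective, and its kernel is the closed two-sided ideal generated by $1-s_\gamma s_\gamma^*$. -/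

import Mathlib

universe u v

noncomputable section

namespace CStarIdeal

variable {A : Type u} [CStarAlgebra A]

/-- The closed two-sided ideal of a C*-algebra generated by a set. -/
def closedIdeal (s : Set A) : Ideal A :=
  sInf {J : Ideal A | J.IsTwoSided ∧ IsClosed (J : Set A) ∧ s ⊆ J}

theorem subset_closedIdeal (s : Set A) : s ⊆ (closedIdeal s : Set A) := by
  intro x hx
  simp only [closedIdeal, SetLike.mem_coe, Submodule.mem_sInf]
  exact fun J hJ => hJ.2.2 hx

instance isTwoSided_closedIdeal (s : Set A) : (closedIdeal s).IsTwoSided where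
  mul_mem_of_left {a} b ha := by
    simp only [closedIdeal, Submodule.mem_sInf] at ha ⊢
    exact fun J hJ => hJ.1.mul_mem_of_left b (ha J hJ)

theorem isClosed_closedIdeal (s : Set A) : IsClosed (closedIdeal s : Set A) := by
  have : (closedIdeal s : Set A) =
      ⋂ J ∈ {J : Ideal A | J.IsTwoSided ∧ IsClosed (J : Set A) ∧ s ⊆ J}, (J : Set A) := by
    simp [closedIdeal, Submodule.coe_sInf]
  rw [this]
  exact isClosed_biInter fun J hJ => hJ.2.1

theorem star_mem_closedIdeal {s : Set A} (hs : ∀ x ∈ s, star x ∈ s) {x : A}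
    (hx : x ∈ closedIdeal s) : star x ∈ closedIdeal s := by
  simp only [closedIdeal, Submodule.mem_sInf] at hx ⊢
  intro J hJ
  have := hJ.1
  let K : Ideal A :=
    { carrier := {y | star y ∈ J}
      add_mem' := fun {a b} ha hb => by
        change star (a + b) ∈ J
        rw [star_add]
        exact J.add_mem ha hb
      zero_mem' := by simp
      smul_mem' := fun c y hy => by
        change star (c * y) ∈ J
        rw [star_mul]
        exact Ideal.mul_mem_right (star c) J hy }
  refine hx K ⟨⟨fun {a} b (ha : star a ∈ J) => ?_⟩, hJ.2.1.preimage continuous_star, fun y hy => hJ.2.2 (hs y hy)⟩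
  change star (a * b) ∈ J
  rw [star_mul]
  exact Ideal.mul_mem_left J _ ha

variable (I : Ideal A)

theorem exists_approx (hI : IsClosed (I : Set A)) (hstar : ∀ x ∈ I, star x ∈ I)
    {x : A} (hx : x ∈ I) {ε : ℝ} (hε : 0 < ε) :
    ∃ e ∈ I, star e = e ∧ ‖1 - e‖ ≤ 1 ∧ ‖x - x * e‖ < ε := by
  let S : NonUnitalStarSubalgebra ℂ A :=
    { carrier := I
      add_mem' := I.add_mem
      zero_mem' := I.zero_mem
      mul_mem' := fun {a b} _ hb => I.mul_mem_left a hb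
      smul_mem' := fun c y hy => by
        have : (c • (1 : A)) * y = c • y := by simp
        exact this ▸ I.mul_mem_left (c • (1 : A)) hy
      star_mem' := fun {a} ha => hstar a ha }
  have : IsClosed (S : Set A) := hI
  let _ : NonUnitalCStarAlgebra S := NonUnitalStarSubalgebra.nonUnitalCStarAlgebra S
  let _ := CStarAlgebra.spectralOrder S
  have := CStarAlgebra.spectralOrderedRing S
  let _ := CStarAlgebra.spectralOrder A
  have := CStarAlgebra.spectralOrderedRing A
  have h := CStarAlgebra.increasingApproximateUnit S
  have h1 := h.tendsto_mul_left ⟨x, hx⟩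
  have h2 : ∀ᶠ e in CStarAlgebra.approximateUnit S, ‖(⟨x, hx⟩ : S) - ⟨x, hx⟩ * e‖ < ε := by
    have := (Metric.tendsto_nhds.1 h1) ε hε
    filter_upwards [this] with e he
    rwa [dist_comm, dist_eq_norm] at he
  obtain ⟨e, ⟨he2, he0⟩, he1⟩ := ((h2.and h.eventually_nonneg).and h.eventually_norm).exists
  have hpos : (0 : A) ≤ e := by
    rw [StarOrderedRing.nonneg_iff] at he0 ⊢
    have : S.toSubmodule.subtype.toAddMonoidHom e ∈
        (AddSubmonoid.closure (Set.range fun s : S => star s * s)).map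
          S.toSubmodule.subtype.toAddMonoidHom := ⟨e, he0, rfl⟩
    rw [AddMonoidHom.map_mclosure] at this
    refine AddSubmonoid.closure_mono ?_ this
    rintro _ ⟨_, ⟨s, rfl⟩, rfl⟩
    exact ⟨s, rfl⟩
  have hIcc : (e : A) ∈ Set.Icc (0 : A) 1 :=
    CStarAlgebra.mem_Icc_iff_norm_le_one.2 ⟨hpos, he1⟩
  refine ⟨e, e.2, (IsSelfAdjoint.of_nonneg hpos).star_eq, ?_, he2⟩
  exact (CStarAlgebra.mem_Icc_iff_norm_le_one.1 (Set.sub_mem_Icc_zero_iff_right.2 hIcc)).2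

variable [I.IsTwoSided]

theorem norm_mk_quotient_le (a : A) : ‖Ideal.Quotient.mk I a‖ ≤ ‖a‖ :=
  Submodule.Quotient.norm_mk_le I a

theorem exists_norm_mk_lt (x : A ⧸ I) {ε : ℝ} (hε : 0 < ε) :
    ∃ a : A, Ideal.Quotient.mk I a = x ∧ ‖a‖ < ‖x‖ + ε :=
  Submodule.Quotient.norm_mk_lt x hε

theorem norm_mul_quotient_le (x y : A ⧸ I) : ‖x * y‖ ≤ ‖x‖ * ‖y‖ := by
  have key : ∀ ε > 0, ‖x * y‖ ≤ (‖x‖ + ε) * (‖y‖ + ε) := by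
    intro ε hε
    obtain ⟨a, rfl, ha⟩ := exists_norm_mk_lt I x hε
    obtain ⟨b, rfl, hb⟩ := exists_norm_mk_lt I y hε
    rw [← map_mul]
    refine (norm_mk_quotient_le I (a * b)).trans ((norm_mul_le a b).trans ?_)
    exact mul_le_mul ha.le hb.le (norm_nonneg _) ((norm_nonneg a).trans ha.le)
  have ht : Filter.Tendsto (fun ε : ℝ => (‖x‖ + ε) * (‖y‖ + ε)) (nhdsWithin 0 (Set.Ioi 0))
      (nhds ((‖x‖ + 0) * (‖y‖ + 0))) :=
    (Continuous.tendsto (by fun_prop) 0).mono_left nhdsWithin_le_nhds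
  rw [add_zero, add_zero] at ht
  exact ge_of_tendsto ht (eventually_mem_nhdsWithin.mono key)

/-- The involution induced on the quotient by a self-adjoint two-sided ideal. -/
def quotientStar (hstar : ∀ x ∈ I, star x ∈ I) : A ⧸ I → A ⧸ I := fun x =>
  Quotient.liftOn' x (fun a => Ideal.Quotient.mk I (star a)) (fun a b hab => by
    rw [Submodule.quotientRel_def] at hab
    rw [Ideal.Quotient.eq, ← star_sub]
    exact hstar _ hab)

theorem quotientStar_mk (hstar : ∀ x ∈ I, star x ∈ I) (a : A) :
    quotientStar I hstar (Ideal.Quotient.mk I a) = Ideal.Quotient.mk I (star a) := rfl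

theorem norm_mul_self_quotient_le (hI : IsClosed (I : Set A)) (hstar : ∀ x ∈ I, star x ∈ I)
    (x : A ⧸ I) : ‖x‖ * ‖x‖ ≤ ‖quotientStar I hstar x * x‖ := by
  refine le_of_forall_pos_le_add fun ε hε => ?_
  obtain ⟨a, rfl⟩ := Ideal.Quotient.mk_surjective x
  rw [quotientStar_mk, ← map_mul]
  obtain ⟨y, hy, hyn⟩ := exists_norm_mk_lt I
    (Ideal.Quotient.mk I (star a * a)) (half_pos hε)
  obtain ⟨e, he, hse, he1, hye⟩ := exists_approx I hI hstar (Ideal.Quotient.eq.1 hy) (half_pos hε)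
  have h1 : ‖Ideal.Quotient.mk I a‖ ≤ ‖a * (1 - e)‖ := by
    have : Ideal.Quotient.mk I a = Ideal.Quotient.mk I (a * (1 - e)) := by
      rw [Ideal.Quotient.eq]
      have h : a - a * (1 - e) = a * e := by noncomm_ring
      rw [h]
      exact I.mul_mem_left a he
    rw [this]
    exact norm_mk_quotient_le I _
  have h2 : ‖a * (1 - e)‖ * ‖a * (1 - e)‖ ≤ ‖star a * a * (1 - e)‖ := by
    rw [← CStarRing.norm_star_mul_self, star_mul, star_sub, star_one, hse, mul_assoc,
      ← mul_assoc (star a)]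
    refine (norm_mul_le _ _).trans (mul_le_of_le_one_left (norm_nonneg _) he1)
  have h3 : star a * a * (1 - e) =
      y * (1 - e) - ((y - star a * a) - (y - star a * a) * e) := by noncomm_ring
  calc ‖Ideal.Quotient.mk I a‖ * ‖Ideal.Quotient.mk I a‖
      ≤ ‖a * (1 - e)‖ * ‖a * (1 - e)‖ :=
        mul_le_mul h1 h1 (norm_nonneg _) (norm_nonneg _)
    _ ≤ ‖star a * a * (1 - e)‖ := h2
    _ ≤ ‖y * (1 - e)‖ + ‖(y - star a * a) - (y - star a * a) * e‖ := by
        rw [h3]; exact norm_sub_le _ _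
    _ ≤ ‖y‖ + ε / 2 :=
        add_le_add ((norm_mul_le _ _).trans (mul_le_of_le_one_right (norm_nonneg _) he1)) hye.le
    _ ≤ ‖Ideal.Quotient.mk I (star a * a)‖ + ε := by linarith

/-- The quotient of a unital C*-algebra by a closed self-adjoint two-sided ideal, with the
quotient norm, is a C*-algebra. -/
@[reducible]
def quotientCStarAlgebra (hI : IsClosed (I : Set A)) (hstar : ∀ x ∈ I, star x ∈ I) :
    CStarAlgebra (A ⧸ I) :=
  haveI := hI
  { Submodule.Quotient.normedAddCommGroup I, Ideal.Quotient.ring I, Ideal.Quotient.algebra ℂ with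
    dist_eq := dist_eq_norm_neg_add
    norm_mul_le := norm_mul_quotient_le I
    star := quotientStar I hstar
    star_involutive := fun x => by
      obtain ⟨a, rfl⟩ := Ideal.Quotient.mk_surjective x
      rw [quotientStar_mk, quotientStar_mk, star_star]
    star_mul := fun x y => by
      obtain ⟨a, rfl⟩ := Ideal.Quotient.mk_surjective x
      obtain ⟨b, rfl⟩ := Ideal.Quotient.mk_surjective y
      rw [← map_mul, quotientStar_mk, star_mul, map_mul, quotientStar_mk, quotientStar_mk]
    star_add := fun x y => by
      obtain ⟨a, rfl⟩ := Ideal.Quotient.mk_surjective x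
      obtain ⟨b, rfl⟩ := Ideal.Quotient.mk_surjective y
      rw [← map_add, quotientStar_mk, star_add, map_add, quotientStar_mk, quotientStar_mk]
    star_smul := fun c x => by
      obtain ⟨a, rfl⟩ := Ideal.Quotient.mk_surjective x
      change quotientStar I hstar (Ideal.Quotient.mk I (c • a)) =
        star c • quotientStar I hstar (Ideal.Quotient.mk I a)
      rw [quotientStar_mk, quotientStar_mk, star_smul]
      rfl
    norm_smul_le := (Submodule.Quotient.normedSpace I ℂ).norm_smul_le
    norm_mul_self_le := norm_mul_self_quotient_le I hI hstar
    complete := (Submodule.Quotient.completeSpace I).complete }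

end CStarIdeal

namespace RotationGraph

open scoped ENNReal ComplexOrder

variable {Z : Type u} [TopologicalSpace Z]

/-- The Hilbert bimodule `X(E)` over `C(Z)` of the topological graph `E = (Z, Z, id, h)`:
as a Banach space it is a copy of `C(Z)`. -/
def GraphModule (_h : Z ≃ₜ Z) : Type u := C(Z, ℂ)

namespace GraphModule

variable {h : Z ≃ₜ Z}

/-- A continuous function regarded as an element of `X(E)`. -/
def of (h : Z ≃ₜ Z) (f : C(Z, ℂ)) : GraphModule h := f

/-- The continuous function underlying an element of `X(E)`. -/
def toFun (x : GraphModule h) : C(Z, ℂ) := x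

/-- The left action `(g · x)(z) = g(z) x(z)`. -/
def leftAct (g : C(Z, ℂ)) (x : GraphModule h) : GraphModule h := of h (g * x.toFun)

/-- The right action `(x · g)(z) = x(z) g(h(z))`. -/
def rightAct (x : GraphModule h) (g : C(Z, ℂ)) : GraphModule h :=
  of h (x.toFun * g.comp (h : C(Z, Z)))

/-- The `C(Z)`-valued inner product `⟨x, y⟩(z) = conj (x(h⁻¹(z))) y(h⁻¹(z))`. -/
instance : Inner C(Z, ℂ) (GraphModule h) where
  inner x y := (star x.toFun * y.toFun).comp (h.symm : C(Z, Z))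

theorem inner_apply (x y : GraphModule h) (z : Z) :
    inner C(Z, ℂ) x y z = star (x.toFun (h.symm z)) * y.toFun (h.symm z) := rfl

theorem rightAct_apply (x : GraphModule h) (g : C(Z, ℂ)) (z : Z) :
    (rightAct x g).toFun z = x.toFun z * g (h z) := rfl

theorem toFun_injective : Function.Injective (toFun : GraphModule h → C(Z, ℂ)) := fun _ _ e => e

theorem rightAct_inner (x y w : GraphModule h) :
    (rightAct x (inner C(Z, ℂ) y w)).toFun = x.toFun * (star y.toFun * w.toFun) := by
  ext z
  simp [rightAct_apply, inner_apply]

variable [CompactSpace Z]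

instance : NormedAddCommGroup (GraphModule h) := inferInstanceAs (NormedAddCommGroup C(Z, ℂ))

instance : NormedSpace ℂ (GraphModule h) := inferInstanceAs (NormedSpace ℂ C(Z, ℂ))

theorem norm_inner_self (x : GraphModule h) : ‖inner C(Z, ℂ) x x‖ = ‖x‖ * ‖x‖ := by
  have h1 : ‖star x.toFun * x.toFun‖ = ‖x‖ * ‖x‖ := CStarRing.norm_star_mul_self (x := x.toFun)
  rw [← h1]
  refine le_antisymm ?_ ?_
  · refine (ContinuousMap.norm_le _ (norm_nonneg _)).2 fun z => ?_
    exact ContinuousMap.norm_coe_le_norm (star x.toFun * x.toFun) (h.symm z)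
  · refine (ContinuousMap.norm_le _ (norm_nonneg _)).2 fun z => ?_
    have := ContinuousMap.norm_coe_le_norm (inner C(Z, ℂ) x x) (h z)
    simpa [inner_apply] using this

/-- The right action as a scalar multiplication (`C(Z)` is commutative). -/
instance : SMul C(Z, ℂ) (GraphModule h) := ⟨fun g x => rightAct x g⟩

instance : CStarModule C(Z, ℂ) (GraphModule h) where
  inner_add_right {x y z} := by
    ext t
    change star (x.toFun _) * (y.toFun _ + z.toFun _) = _
    rw [mul_add]
    rfl
  inner_self_nonneg {x} := by
    intro t
    exact star_mul_self_nonneg (x.toFun (h.symm t))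
  inner_self {x} := by
    rw [← norm_eq_zero, norm_inner_self, mul_self_eq_zero, norm_eq_zero]
  inner_op_smul_right {a x y} := by
    ext t
    change star (x.toFun _) * (y.toFun _ * a (h (h.symm t))) = a t * (star (x.toFun _) * y.toFun _)
    rw [h.apply_symm_apply]
    ring
  inner_smul_right_complex {c x y} := by
    ext t
    change star (x.toFun _) * (c * y.toFun _) = c * (star (x.toFun _) * y.toFun _)
    ring
  star_inner x y := by
    ext t
    change star (star (x.toFun _) * y.toFun _) = star (y.toFun _) * x.toFun _
    rw [star_mul, star_star]
  norm_eq_sqrt_norm_inner_self x := by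
    rw [norm_inner_self, Real.sqrt_mul_self (norm_nonneg x)]

/-- The rank-one operator `Θ_{x, y}(w) = x · ⟨y, w⟩`. -/
def theta (x y : GraphModule h) : GraphModule h →L[ℂ] GraphModule h :=
  LinearMap.mkContinuous
    { toFun := fun w => rightAct x (inner C(Z, ℂ) y w)
      map_add' := fun v w => by
        apply toFun_injective
        change _ = (rightAct x (inner C(Z, ℂ) y v)).toFun + (rightAct x (inner C(Z, ℂ) y w)).toFun
        rw [rightAct_inner, rightAct_inner, rightAct_inner, ← mul_add, ← mul_add]
        rfl
      map_smul' := fun c w => by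
        apply toFun_injective
        change _ = c • (rightAct x (inner C(Z, ℂ) y w)).toFun
        rw [rightAct_inner, rightAct_inner, ← mul_smul_comm, ← mul_smul_comm]
        rfl }
    (‖x‖ * ‖y‖) (fun w => by
      change ‖(rightAct x (inner C(Z, ℂ) y w)).toFun‖ ≤ _
      rw [rightAct_inner, mul_assoc]
      refine (norm_mul_le _ _).trans (mul_le_mul_of_nonneg_left ?_ (norm_nonneg _))
      refine (norm_mul_le _ _).trans (mul_le_mul_of_nonneg_right ?_ (norm_nonneg _))
      exact (norm_star y.toFun).le)

theorem theta_apply (x y w : GraphModule h) :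
    theta x y w = rightAct x (inner C(Z, ℂ) y w) := rfl

/-- The generalised compact operators on `X(E)`: the closed linear span of the operators
`Θ_{x, y}`. -/
def compacts (h : Z ≃ₜ Z) : Submodule ℂ (GraphModule h →L[ℂ] GraphModule h) :=
  (Submodule.span ℂ {T | ∃ x y : GraphModule h, theta x y = T}).topologicalClosure

theorem theta_mem_compacts (x y : GraphModule h) : theta x y ∈ compacts h :=
  Submodule.le_topologicalClosure _ (Submodule.subset_span ⟨x, y, rfl⟩)

/-- The operator `φ(g)` of left multiplication by `g`. -/
def leftMul (h : Z ≃ₜ Z) (g : C(Z, ℂ)) : GraphModule h →L[ℂ] GraphModule h :=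
  LinearMap.mkContinuous
    { toFun := fun w => leftAct g w
      map_add' := fun v w => mul_add g v.toFun w.toFun
      map_smul' := fun c w => mul_smul_comm c g w.toFun }
    ‖g‖ (fun w => norm_mul_le g w.toFun)

theorem leftMul_apply (g : C(Z, ℂ)) (w : GraphModule h) : leftMul h g w = leftAct g w := rfl

theorem leftMul_eq_theta (g : C(Z, ℂ)) : leftMul h g = theta (of h g) (of h 1) := by
  ext1 w
  apply toFun_injective
  rw [theta_apply, rightAct_inner]
  change g * w.toFun = g * (star 1 * w.toFun)
  rw [star_one, one_mul]

theorem leftMul_mem_compacts (g : C(Z, ℂ)) : leftMul h g ∈ compacts h :=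
  leftMul_eq_theta g ▸ theta_mem_compacts _ _

end GraphModule

open GraphModule

variable [CompactSpace Z]

/-- A representation `(ψ, π)` of `X(E)` in a C*-algebra `B`; `lin` is `ψ` and `hom` is `π`. -/
structure Representation (h : Z ≃ₜ Z) (B : Type*) [NonUnitalCStarAlgebra B] where
  lin : GraphModule h →ₗ[ℂ] B
  hom : C(Z, ℂ) →⋆ₙₐ[ℂ] B
  map_rightAct : ∀ (x : GraphModule h) (g : C(Z, ℂ)), lin (rightAct x g) = lin x * hom g
  star_lin_mul_lin : ∀ x y : GraphModule h, star (lin x) * lin y = hom (inner C(Z, ℂ) x y)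
  map_leftAct : ∀ (g : C(Z, ℂ)) (x : GraphModule h), lin (leftAct g x) = hom g * lin x

namespace Representation

variable {h : Z ≃ₜ Z} {B : Type*} [NonUnitalCStarAlgebra B] (ρ : Representation h B)

theorem norm_hom_le (g : C(Z, ℂ)) : ‖ρ.hom g‖ ≤ ‖g‖ := NonUnitalStarAlgHom.norm_apply_le ρ.hom g

theorem norm_lin_le (x : GraphModule h) : ‖ρ.lin x‖ ≤ ‖x‖ := by
  refine le_of_sq_le_sq ?_ (norm_nonneg x)
  rw [sq, sq, ← CStarRing.norm_star_mul_self, ρ.star_lin_mul_lin, ← norm_inner_self]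
  exact ρ.norm_hom_le _

/-- The map `(ψ, π)⁽¹⁾` on the generalised compact operators, determined by
`(ψ, π)⁽¹⁾(Θ_{x, y}) = ψ(x) ψ(y)^*` (see `onCompacts_theta` and `onCompacts_unique`). Since `X(E)` is
generated by `1` as a right module, it is given by the formula `T ↦ ψ(T 1) ψ(1)^*`. -/
def onCompacts : compacts h →L[ℂ] B :=
  LinearMap.mkContinuous
    { toFun := fun T => ρ.lin ((T : GraphModule h →L[ℂ] GraphModule h) (of h 1)) *
        star (ρ.lin (of h 1))
      map_add' := fun S T => by simp [add_mul]
      map_smul' := fun c T => by simp [smul_mul_assoc] }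
    (‖of h 1‖ * ‖ρ.lin (of h 1)‖) (fun T => by
      refine (norm_mul_le _ _).trans ?_
      rw [norm_star, mul_right_comm, mul_comm ‖of h 1‖]
      refine mul_le_mul_of_nonneg_right ?_ (norm_nonneg _)
      exact (ρ.norm_lin_le _).trans
        ((T : GraphModule h →L[ℂ] GraphModule h).le_opNorm (of h 1)))

theorem onCompacts_theta (x y : GraphModule h) :
    ρ.onCompacts ⟨theta x y, theta_mem_compacts x y⟩ = ρ.lin x * star (ρ.lin y) := by
  change ρ.lin (rightAct x (inner C(Z, ℂ) y (of h 1))) * star (ρ.lin (of h 1)) = _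
  have h1 : y = rightAct (of h 1) (inner C(Z, ℂ) (of h 1) y) := by
    apply toFun_injective
    rw [rightAct_inner]
    change y.toFun = 1 * (star 1 * y.toFun)
    rw [star_one, one_mul, one_mul]
  rw [ρ.map_rightAct, mul_assoc, ← CStarModule.star_inner (A := C(Z, ℂ)) (of h 1) y, map_star, ← star_mul,
    ← ρ.map_rightAct, ← h1]

theorem onCompacts_unique (Ψ : compacts h →L[ℂ] B)
    (hΨ : ∀ x y, Ψ ⟨theta x y, theta_mem_compacts x y⟩ = ρ.lin x * star (ρ.lin y)) :
    Ψ = ρ.onCompacts := by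
  have key : ∀ T (hT : T ∈ compacts h), Ψ ⟨T, hT⟩ = ρ.onCompacts ⟨T, hT⟩ := by
    have hcl : IsClosed {T : compacts h | Ψ T = ρ.onCompacts T} :=
      isClosed_eq Ψ.continuous ρ.onCompacts.continuous
    have hspan : ∀ T (hT : T ∈ Submodule.span ℂ {T | ∃ x y : GraphModule h, theta x y = T}),
        Ψ ⟨T, Submodule.le_topologicalClosure _ hT⟩ =
          ρ.onCompacts ⟨T, Submodule.le_topologicalClosure _ hT⟩ := by
      intro T hT
      induction hT using Submodule.span_induction with
      | mem T hT =>
        obtain ⟨x, y, rfl⟩ := hT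
        exact (hΨ x y).trans (ρ.onCompacts_theta x y).symm
      | zero => exact (map_zero Ψ).trans (map_zero ρ.onCompacts).symm
      | add S T hS hT iS iT =>
        exact (map_add Ψ ⟨S, _⟩ ⟨T, _⟩).trans
          ((congrArg₂ (· + ·) iS iT).trans (map_add ρ.onCompacts ⟨S, _⟩ ⟨T, _⟩).symm)
      | smul c T hT iT =>
        exact (map_smul Ψ c ⟨T, _⟩).trans
          ((congrArg (c • ·) iT).trans (map_smul ρ.onCompacts c ⟨T, _⟩).symm)
    intro T hT
    obtain ⟨u, hu, hlim⟩ := mem_closure_iff_seq_limit.1 hT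
    have hlim' : Filter.Tendsto
        (fun n => (⟨u n, Submodule.le_topologicalClosure _ (hu n)⟩ : compacts h))
        Filter.atTop (nhds ⟨T, hT⟩) := tendsto_subtype_rng.2 hlim
    exact hcl.mem_of_tendsto hlim' (Filter.Eventually.of_forall fun n => hspan _ (hu n))
  ext T
  exact key T.1 T.2

theorem star_onCompacts_leftMul (g : C(Z, ℂ)) :
    star (ρ.onCompacts ⟨leftMul h g, leftMul_mem_compacts g⟩) =
      ρ.onCompacts ⟨leftMul h (star g), leftMul_mem_compacts (star g)⟩ := by
  have e1 : ∀ f : C(Z, ℂ), ρ.onCompacts ⟨leftMul h f, leftMul_mem_compacts f⟩ =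
      ρ.lin (leftAct f (of h 1)) * star (ρ.lin (of h 1)) := fun _ => rfl
  have e2 : leftAct g (of h 1) = rightAct (of h 1) (g.comp (h.symm : C(Z, Z))) := by
    apply toFun_injective
    ext z
    change g z * 1 = 1 * g (h.symm (h z))
    rw [h.symm_apply_apply, mul_one, one_mul]
  have e3 : leftAct (star g) (of h 1) =
      rightAct (of h 1) (star (g.comp (h.symm : C(Z, Z)))) := by
    apply toFun_injective
    ext z
    change star (g z) * 1 = 1 * star (g (h.symm (h z)))
    rw [h.symm_apply_apply, mul_one, one_mul]
  rw [e1, e1, e2, e3, ρ.map_rightAct, ρ.map_rightAct, map_star, star_mul, star_star, star_mul,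
    mul_assoc]

/-- The composition of a representation with a *-homomorphism. -/
def map {C : Type*} [NonUnitalCStarAlgebra C] (q : B →⋆ₙₐ[ℂ] C) : Representation h C where
  lin := (q : B →ₗ[ℂ] C) ∘ₗ ρ.lin
  hom := q.comp ρ.hom
  map_rightAct x g := (congrArg q (ρ.map_rightAct x g)).trans (map_mul q _ _)
  star_lin_mul_lin x y := by
    refine Eq.trans ?_ (congrArg q (ρ.star_lin_mul_lin x y))
    rw [map_mul, map_star]
    rfl
  map_leftAct g x := (congrArg q (ρ.map_leftAct g x)).trans (map_mul q _ _)

end Representation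

/-- A C*-algebra with a unit element is a unital C*-algebra. -/
@[reducible]
def unitalOfUnit {B : Type*} (inst : NonUnitalCStarAlgebra B) (e : B)
    (he : ∀ a : B, e * a = a) (he' : ∀ a : B, a * e = a) : CStarAlgebra B :=
  letI ring : Ring B := { inst with one := e, one_mul := he, mul_one := he' }
  letI alg : Algebra ℂ B := Algebra.ofModule smul_mul_assoc mul_smul_comm
  { inst, ring, alg with }

/-- A representation of `X(E)` together with the C*-algebra in which it takes its values. -/
structure RepresentationIn (h : Z ≃ₜ Z) : Type (u + 1) where
  B : Type u
  [inst : NonUnitalCStarAlgebra B]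
  rep : Representation h B

attribute [instance] RepresentationIn.inst

/-- The `ℓ^∞`-direct sum of the targets of all representations of `X(E)`. -/
abbrev BigSum (h : Z ≃ₜ Z) : Type (u + 1) := lp (fun ρ : RepresentationIn h => ρ.B) ∞

/-- The direct sum of the maps `ψ` over all representations `(ψ, π)`. -/
def bigLin (h : Z ≃ₜ Z) : GraphModule h →ₗ[ℂ] BigSum h where
  toFun x := ⟨fun ρ => ρ.rep.lin x, memℓp_infty ⟨‖x‖, by
    rintro _ ⟨ρ, rfl⟩; exact ρ.rep.norm_lin_le x⟩⟩
  map_add' x y := by ext ρ; exact map_add _ x y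
  map_smul' c x := by ext ρ; simp

/-- The direct sum of the homomorphisms `π` over all representations `(ψ, π)`. -/
def bigHom (h : Z ≃ₜ Z) : C(Z, ℂ) →⋆ₙₐ[ℂ] BigSum h where
  toFun g := ⟨fun ρ => ρ.rep.hom g, memℓp_infty ⟨‖g‖, by
    rintro _ ⟨ρ, rfl⟩; exact ρ.rep.norm_hom_le g⟩⟩
  map_add' x y := by ext ρ; exact map_add _ x y
  map_smul' c x := by ext ρ; simp
  map_zero' := by ext ρ; simp
  map_mul' x y := by ext ρ; simp
  map_star' x := by ext ρ; simp [map_star]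

/-- The C*-subalgebra of the direct sum generated by the ranges of the two universal maps. -/
def toeplitzSubalgebra (h : Z ≃ₜ Z) : NonUnitalStarSubalgebra ℂ (BigSum h) :=
  (NonUnitalStarAlgebra.adjoin ℂ
    (Set.range (bigLin h) ∪ Set.range (bigHom h))).topologicalClosure

/-- The Toeplitz algebra `T(E)`, the universal C*-algebra generated by a representation
of `X(E)`: the C*-algebra generated by the direct sum of all representations. Targets `B : Type u` suffice, since
every representation takes its values in a C*-algebra small enough to live in `Type u`. -/
def ToeplitzAlgebra (h : Z ≃ₜ Z) : Type (u + 1) := toeplitzSubalgebra h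

namespace ToeplitzAlgebra

variable {h : Z ≃ₜ Z}

theorem lin_mem (x : GraphModule h) : bigLin h x ∈ toeplitzSubalgebra h :=
  NonUnitalStarSubalgebra.le_topologicalClosure _
    (NonUnitalStarAlgebra.subset_adjoin ℂ _ (Or.inl ⟨x, rfl⟩))

theorem hom_mem (g : C(Z, ℂ)) : bigHom h g ∈ toeplitzSubalgebra h :=
  NonUnitalStarSubalgebra.le_topologicalClosure _
    (NonUnitalStarAlgebra.subset_adjoin ℂ _ (Or.inr ⟨g, rfl⟩))

theorem hom_one_mul_and {a : BigSum h} (ha : a ∈ toeplitzSubalgebra h) :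
    bigHom h 1 * a = a ∧ a * bigHom h 1 = a := by
  have hsa : star (bigHom h 1) = bigHom h 1 := by rw [← map_star, star_one]
  have hcl : IsClosed {a : BigSum h | bigHom h 1 * a = a ∧ a * bigHom h 1 = a} :=
    (isClosed_eq (continuous_const.mul continuous_id) continuous_id).inter
      (isClosed_eq (continuous_id.mul continuous_const) continuous_id)
  refine closure_minimal (s := (NonUnitalStarAlgebra.adjoin ℂ
    (Set.range (bigLin h) ∪ Set.range (bigHom h)) : Set (BigSum h))) ?_ hcl ha
  intro b hb
  induction hb using NonUnitalStarAlgebra.adjoin_induction with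
  | mem x hx =>
    rcases hx with ⟨x, rfl⟩ | ⟨g, rfl⟩
    · constructor
      · ext ρ
        refine (ρ.rep.map_leftAct 1 x).symm.trans (congrArg ρ.rep.lin ?_)
        exact toFun_injective (one_mul x.toFun)
      · ext ρ
        refine (ρ.rep.map_rightAct x 1).symm.trans (congrArg ρ.rep.lin ?_)
        exact toFun_injective (mul_one x.toFun)
    · exact ⟨by rw [← map_mul, one_mul], by rw [← map_mul, mul_one]⟩
  | add x y _ _ hx hy => exact ⟨by rw [mul_add, hx.1, hy.1], by rw [add_mul, hx.2, hy.2]⟩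
  | zero => exact ⟨mul_zero _, zero_mul _⟩
  | mul x y _ _ hx hy => exact ⟨by rw [← mul_assoc, hx.1], by rw [mul_assoc, hy.2]⟩
  | smul c x _ hx => exact ⟨by rw [mul_smul_comm, hx.1], by rw [smul_mul_assoc, hx.2]⟩
  | star x _ hx =>
    refine ⟨?_, ?_⟩
    · conv_lhs => rw [← hsa, ← star_mul, hx.2]
    · conv_lhs => rw [← hsa, ← star_mul, hx.1]

/-- `T(E)` as a C*-algebra, before its unit is taken into account. -/
@[reducible]
def nonUnital (h : Z ≃ₜ Z) : NonUnitalCStarAlgebra (ToeplitzAlgebra h) :=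
  haveI : IsClosed (toeplitzSubalgebra h : Set (BigSum h)) :=
    NonUnitalStarSubalgebra.isClosed_topologicalClosure _
  NonUnitalStarSubalgebra.nonUnitalCStarAlgebra (toeplitzSubalgebra h)

/-- `T(E)` is a unital C*-algebra whose unit is the image of `1 ∈ C(Z)`. -/
instance (h : Z ≃ₜ Z) : CStarAlgebra (ToeplitzAlgebra h) :=
  unitalOfUnit (nonUnital h) (⟨bigHom h 1, hom_mem 1⟩ : toeplitzSubalgebra h)
    (fun a => Subtype.ext (hom_one_mul_and a.2).1) (fun a => Subtype.ext (hom_one_mul_and a.2).2)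

/-- The universal representation of `X(E)` in `T(E)`. -/
def rep (h : Z ≃ₜ Z) : Representation h (ToeplitzAlgebra h) where
  lin :=
    { toFun := fun x => (⟨bigLin h x, lin_mem x⟩ : toeplitzSubalgebra h)
      map_add' := fun x y => Subtype.ext (map_add (bigLin h) x y)
      map_smul' := fun c x => Subtype.ext (map_smul (bigLin h) c x) }
  hom :=
    { toFun := fun g => (⟨bigHom h g, hom_mem g⟩ : toeplitzSubalgebra h)
      map_smul' := fun c g => Subtype.ext (map_smul (bigHom h) c g)
      map_zero' := Subtype.ext (map_zero (bigHom h))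
      map_add' := fun f g => Subtype.ext (map_add (bigHom h) f g)
      map_mul' := fun f g => Subtype.ext (map_mul (bigHom h) f g)
      map_star' := fun g => Subtype.ext (map_star (bigHom h) g) }
  map_rightAct x g := Subtype.ext (by ext ρ; exact ρ.rep.map_rightAct x g)
  star_lin_mul_lin x y := Subtype.ext (by ext ρ; exact ρ.rep.star_lin_mul_lin x y)
  map_leftAct g x := Subtype.ext (by ext ρ; exact ρ.rep.map_leftAct g x)

end ToeplitzAlgebra

/-- The elements `(i¹, i⁰)⁽¹⁾(φ(g)) - i⁰(g)` of `T(E)`, for `g ∈ C(Z)`. -/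
def covarianceSet (h : Z ≃ₜ Z) : Set (ToeplitzAlgebra h) :=
  Set.range fun g : C(Z, ℂ) =>
    (ToeplitzAlgebra.rep h).onCompacts ⟨leftMul h g, leftMul_mem_compacts g⟩ -
      (ToeplitzAlgebra.rep h).hom g

theorem star_mem_covarianceSet (h : Z ≃ₜ Z) :
    ∀ x ∈ covarianceSet h, star x ∈ covarianceSet h := by
  rintro _ ⟨g, rfl⟩
  exact ⟨star g, by simp only [star_sub, Representation.star_onCompacts_leftMul, map_star]⟩

/-- The closed two-sided ideal of `T(E)` generated by the covariance relations. -/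
def covarianceIdeal (h : Z ≃ₜ Z) : Ideal (ToeplitzAlgebra h) :=
  CStarIdeal.closedIdeal (covarianceSet h)

instance (h : Z ≃ₜ Z) : (covarianceIdeal h).IsTwoSided :=
  CStarIdeal.isTwoSided_closedIdeal (covarianceSet h)

/-- The graph C*-algebra `O(E)`, that is, the Cuntz–Pimsner algebra of `X(E)`: the quotient of
`T(E)` by the closed ideal generated by the elements `(i¹, i⁰)⁽¹⁾(φ(g)) - i⁰(g)`. -/
def GraphAlgebra (h : Z ≃ₜ Z) : Type (u + 1) := ToeplitzAlgebra h ⧸ covarianceIdeal h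

namespace GraphAlgebra

instance (h : Z ≃ₜ Z) : CStarAlgebra (GraphAlgebra h) :=
  CStarIdeal.quotientCStarAlgebra (covarianceIdeal h) (CStarIdeal.isClosed_closedIdeal _)
    (fun _ => CStarIdeal.star_mem_closedIdeal (star_mem_covarianceSet h))

/-- The quotient map `q : T(E) → O(E)`. -/
def quotientMap (h : Z ≃ₜ Z) : ToeplitzAlgebra h →⋆ₐ[ℂ] GraphAlgebra h where
  toFun := Ideal.Quotient.mk (covarianceIdeal h)
  map_one' := rfl
  map_mul' _ _ := rfl
  map_zero' := rfl
  map_add' _ _ := rfl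
  commutes' _ := rfl
  map_star' _ := rfl

/-- The representation `(q ∘ i¹, q ∘ i⁰)` of `X(E)` in `O(E)`. -/
def rep (h : Z ≃ₜ Z) : Representation h (GraphAlgebra h) :=
  (ToeplitzAlgebra.rep h).map (quotientMap h).toNonUnitalStarAlgHom

end GraphAlgebra

/-! ### Rotations of the circle -/

/-- The rotation `R_γ(t) = t - γ (mod 1)` of the circle `ℝ/ℤ`. -/
def rotation (γ : ℝ) : UnitAddCircle ≃ₜ UnitAddCircle := Homeomorph.subRight (γ : UnitAddCircle)

/-- A Toeplitz pair for the topological graph `E_γ = (ℝ/ℤ, ℝ/ℤ, id, R_γ)` in a unital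
C*-algebra `B`: a unital *-homomorphism `π : C(ℝ/ℤ) → B` and an isometry `S ∈ B` such that
`S π(f) = π(f ∘ R_γ) S` for all `f`. -/
structure IsToeplitzPair (γ : ℝ) {B : Type*} [CStarAlgebra B]
    (π : C(UnitAddCircle, ℂ) →⋆ₙₐ[ℂ] B) (S : B) : Prop where
  map_one : π 1 = 1
  isometry : star S * S = 1
  intertwines : ∀ f : C(UnitAddCircle, ℂ),
    S * π f = π (f.comp (rotation γ : C(UnitAddCircle, UnitAddCircle))) * S

/-- A covariant pair is a Toeplitz pair whose isometry is a unitary. -/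
structure IsCovariantPair (γ : ℝ) {B : Type*} [CStarAlgebra B]
    (π : C(UnitAddCircle, ℂ) →⋆ₙₐ[ℂ] B) (W : B) : Prop extends IsToeplitzPair γ π W where
  unitary : W ∈ unitary B

/-- The C*-algebra generated by the range of `π` and the element `S` is all of `B`. -/
def Generates {B : Type*} [NonUnitalCStarAlgebra B] (π : C(UnitAddCircle, ℂ) →⋆ₙₐ[ℂ] B) (S : B) :
    Prop :=
  (NonUnitalStarAlgebra.adjoin ℂ (Set.range π ∪ {S})).topologicalClosure = ⊤

/-- The Toeplitz algebra `T(E_γ)`. -/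
abbrev ToeplitzRotation (γ : ℝ) : Type 1 := ToeplitzAlgebra (rotation γ)

/-- The graph C*-algebra `O(E_γ)`. -/
abbrev GraphRotation (γ : ℝ) : Type 1 := GraphAlgebra (rotation γ)

/-- The homomorphism `i_γ : C(ℝ/ℤ) → T(E_γ)`. -/
def iHom (γ : ℝ) : C(UnitAddCircle, ℂ) →⋆ₙₐ[ℂ] ToeplitzRotation γ :=
  (ToeplitzAlgebra.rep (rotation γ)).hom

/-- The element `s_γ = i¹(1)` of `T(E_γ)`. -/
def sElt (γ : ℝ) : ToeplitzRotation γ :=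
  (ToeplitzAlgebra.rep (rotation γ)).lin (GraphModule.of (rotation γ) 1)

/-- The homomorphism `j_γ : C(ℝ/ℤ) → O(E_γ)`. -/
def jHom (γ : ℝ) : C(UnitAddCircle, ℂ) →⋆ₙₐ[ℂ] GraphRotation γ :=
  (GraphAlgebra.rep (rotation γ)).hom

/-- The element `w_γ = j¹(1)` of `O(E_γ)`. -/
def wElt (γ : ℝ) : GraphRotation γ :=
  (GraphAlgebra.rep (rotation γ)).lin (GraphModule.of (rotation γ) 1)

end RotationGraph

end

/-!
Representations `(ψ, π)` of the bimodule `X(E_γ)` and Toeplitz pairs `(π, S)` are the same data.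
As a left module `X(E_γ)` is generated by the constant function `1`, so `ψ(x) = π(x) ψ(1)` and
`S = ψ(1)` determines `ψ`; the inner product relation for `ψ` says that `S` is an isometry, and the
two module relations together say `S π(f) = π(f ∘ R_γ) S`. The passage in the two directions is
`Representation.isToeplitzPair` and `IsToeplitzPair.representation`. Hence the universal property of
`T(E_γ)` for representations is the one for Toeplitz pairs, and `i_γ`, `s_γ` generate.

`T(E)` is built inside the direct sum of all representations on C*-algebras in one fixed universe,
so its universal property for a target in another universe needs an argument. The C*-subalgebra
generated by a representation consists of limits of sequences of polynomials in the generators, so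
it is in bijection with a type in the fixed universe (`small_adjoin`, `small_closure`). The
C*-structure is carried over along that bijection, and the coordinate projection of the direct sum at
the resulting representation is the homomorphism required (`ToeplitzAlgebra.exists_lift`).

For the graph algebra, `(i¹, i⁰)⁽¹⁾(φ(g)) = i⁰(g) s s*`, so that the covariance relation at `g` is
a multiple of `1 - s s*`, and the relation at `g = 1` is `1 - s s*` up to sign. The kernel of the
quotient map is therefore the closed ideal generated by `1 - s s*` (`covarianceIdeal_eq`), and the
homomorphism of `T(E_γ)` given by a Toeplitz pair factors through `O(E_γ)` when its isometry is a
unitary. Uniqueness holds in both cases because homomorphisms of C*-algebras are continuous.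
-/

noncomputable section

/-! ### Small C*-algebras -/

namespace CStarTransfer

universe w

/-- A C*-algebra structure transported along a bijection. -/
@[reducible]
def nonUnitalCStarAlgebra {α : Type w} {A : Type v} [NonUnitalCStarAlgebra A] (e : α ≃ A) :
    NonUnitalCStarAlgebra α :=
  letI ring : NonUnitalRing α := e.nonUnitalRing
  letI mod : Module ℂ α := e.module ℂ
  let f : α →ₙₐ[ℂ] A :=
    { toFun := e
      map_smul' := fun _ _ => e.apply_symm_apply _
      map_zero' := e.apply_symm_apply _
      map_add' := fun _ _ => e.apply_symm_apply _
      map_mul' := fun _ _ => e.apply_symm_apply _ }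
  letI nring : NonUnitalNormedRing α := NonUnitalNormedRing.induced α A f e.injective
  letI nsp : NormedSpace ℂ α := NormedSpace.induced ℂ α A f
  { nring, nsp with
    star := fun x => e.symm (star (e x))
    star_involutive := fun x => by
      apply e.injective
      change e (e.symm (star (e (e.symm (star (e x)))))) = e x
      simp
    star_mul := fun x y => by
      apply e.injective
      change e (e.symm (star (f (x * y)))) = f (e.symm (star (e y)) * e.symm (star (e x)))
      rw [map_mul, map_mul]
      simp [f]
    star_add := fun x y => by
      apply e.injective
      change e (e.symm (star (f (x + y)))) = f (e.symm (star (e x)) + e.symm (star (e y)))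
      rw [map_add, map_add]
      simp [f]
    star_smul := fun c x => by
      apply e.injective
      change e (e.symm (star (f (c • x)))) = f (star c • e.symm (star (e x)))
      rw [map_smul, map_smul]
      simp [f]
    complete := by
      have hi : IsUniformInducing e := ⟨rfl⟩
      have := hi.completeSpace (e.surjective.range_eq ▸ isClosed_univ.isComplete)
      exact fun {_} => CompleteSpace.complete
    norm_mul_self_le := fun x => by
      change ‖e x‖ * ‖e x‖ ≤ ‖f (e.symm (star (e x)) * x)‖
      rw [map_mul]
      simp only [f, NonUnitalAlgHom.coe_mk]
      rw [e.apply_symm_apply, CStarRing.norm_star_mul_self]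
    smul_assoc := fun c x y => by
      apply e.injective
      change f ((c • x) * y) = f (c • (x * y))
      simp only [map_mul, map_smul, smul_mul_assoc]
    smul_comm := fun c x y => by
      apply e.injective
      change f (c • (x * y)) = f (x * (c • y))
      simp only [map_mul, map_smul, mul_smul_comm] }

/-- The bijection along which a C*-algebra structure is transported, as a *-isomorphism. -/
def starAlgEquiv {α : Type w} {A : Type v} [NonUnitalCStarAlgebra A] (e : α ≃ A) :
    letI := nonUnitalCStarAlgebra e
    α ≃⋆ₐ[ℂ] A :=
  letI := nonUnitalCStarAlgebra e
  { e with
    map_smul' := fun _ _ => e.apply_symm_apply _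
    map_add' := fun _ _ => e.apply_symm_apply _
    map_mul' := fun _ _ => e.apply_symm_apply _
    map_star' := fun _ => e.apply_symm_apply _ }

/-- Every element of the adjoined algebra is the value of a non-associative polynomial in the
generators and their adjoints, and there are only as many of these as the universe of the
generators allows. -/
theorem small_adjoin {A : Type v} [NonUnitalCStarAlgebra A] (s : Set A) [Small.{w} s] :
    Small.{w} (NonUnitalStarAlgebra.adjoin ℂ s) := by
  have : Small.{w} (star s : Set A) := by
    rw [← Set.image_star]
    infer_instance
  let t : Set A := s ∪ star s
  let F : FreeNonUnitalNonAssocAlgebra ℂ (Shrink.{w} t) →ₙₐ[ℂ] A :=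
    FreeNonUnitalNonAssocAlgebra.lift ℂ fun x => ((equivShrink t).symm x : A)
  have hsub : ((NonUnitalStarAlgebra.adjoin ℂ s : NonUnitalStarSubalgebra ℂ A) : Set A) ⊆
      Set.range F := by
    have h : NonUnitalAlgebra.adjoin ℂ t ≤ NonUnitalAlgHom.range F :=
      NonUnitalAlgebra.adjoin_le fun x hx =>
        ⟨FreeNonUnitalNonAssocAlgebra.of ℂ (equivShrink t ⟨x, hx⟩), by
          refine (FreeNonUnitalNonAssocAlgebra.lift_of_apply _ _ _).trans ?_
          simp⟩
    exact fun x hx => h hx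
  exact small_subset hsub

/-- Points of the closure are limits of sequences, and the sequences in a small set form a small
type. -/
theorem small_closure {X : Type v} [TopologicalSpace X] [FrechetUrysohnSpace X] [T2Space X]
    (s : Set X) [Small.{w} s] : Small.{w} (closure s) := by
  rcases isEmpty_or_nonempty X with hX | hX
  · infer_instance
  · have hsub : closure s ⊆ Set.range fun u : ℕ → s =>
        Filter.limUnder Filter.atTop (fun n => (u n : X)) := by
      intro x hx
      obtain ⟨u, hu, hlim⟩ := mem_closure_iff_seq_limit.1 hx
      exact ⟨fun n => ⟨u n, hu n⟩, hlim.limUnder_eq⟩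
    exact small_subset hsub

end CStarTransfer

namespace RotationGraph

open GraphModule
open scoped CStarAlgebra

/-! ### The universal property of the Toeplitz algebra -/

section General

variable {Z : Type u} [TopologicalSpace Z]

theorem GraphModule.leftAct_of_one {h : Z ≃ₜ Z} (x : GraphModule h) :
    leftAct x.toFun (of h 1) = x :=
  toFun_injective (mul_one x.toFun)

variable [CompactSpace Z] {h : Z ≃ₜ Z}

namespace Representation

variable {B : Type v} [NonUnitalCStarAlgebra B] (ρ : Representation h B)

/-- The C*-subalgebra generated by a representation. -/
def generated : NonUnitalStarSubalgebra ℂ B :=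
  (NonUnitalStarAlgebra.adjoin ℂ (Set.range ρ.lin ∪ Set.range ρ.hom)).topologicalClosure

theorem lin_mem_generated (x : GraphModule h) : ρ.lin x ∈ ρ.generated :=
  NonUnitalStarSubalgebra.le_topologicalClosure _
    (NonUnitalStarAlgebra.subset_adjoin ℂ _ (Or.inl ⟨x, rfl⟩))

theorem hom_mem_generated (g : C(Z, ℂ)) : ρ.hom g ∈ ρ.generated :=
  NonUnitalStarSubalgebra.le_topologicalClosure _
    (NonUnitalStarAlgebra.subset_adjoin ℂ _ (Or.inr ⟨g, rfl⟩))

instance : IsClosed (ρ.generated : Set B) :=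
  NonUnitalStarSubalgebra.isClosed_topologicalClosure _

/-- The algebra generated by a representation fits into the universe of `Z`, whatever the universe of
`B`. -/
instance : Small.{u} ρ.generated := by
  have : Small.{u} (Set.range ρ.lin) :=
    @small_range (GraphModule h) _ ρ.lin (small_self C(Z, ℂ))
  have := CStarTransfer.small_adjoin.{v, u} (Set.range ρ.lin ∪ Set.range ρ.hom)
  exact CStarTransfer.small_closure _

/-- A representation, with its target cut down to the C*-subalgebra that it generates. -/
def corestrict : Representation h ρ.generated where
  lin :=
    { toFun := fun x => ⟨ρ.lin x, ρ.lin_mem_generated x⟩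
      map_add' := fun x y => Subtype.ext (map_add ρ.lin x y)
      map_smul' := fun c x => Subtype.ext (map_smul ρ.lin c x) }
  hom :=
    { toFun := fun g => ⟨ρ.hom g, ρ.hom_mem_generated g⟩
      map_smul' := fun c g => Subtype.ext (map_smul ρ.hom c g)
      map_zero' := Subtype.ext (map_zero ρ.hom)
      map_add' := fun f g => Subtype.ext (map_add ρ.hom f g)
      map_mul' := fun f g => Subtype.ext (map_mul ρ.hom f g)
      map_star' := fun g => Subtype.ext (map_star ρ.hom g) }
  map_rightAct x g := Subtype.ext (ρ.map_rightAct x g)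
  star_lin_mul_lin x y := Subtype.ext (ρ.star_lin_mul_lin x y)
  map_leftAct g x := Subtype.ext (ρ.map_leftAct g x)

theorem lin_eq_hom_mul (x : GraphModule h) : ρ.lin x = ρ.hom x.toFun * ρ.lin (of h 1) := by
  rw [← ρ.map_leftAct, leftAct_of_one]

theorem star_lin_one_mul_lin_one : star (ρ.lin (of h 1)) * ρ.lin (of h 1) = ρ.hom 1 := by
  rw [ρ.star_lin_mul_lin]
  congr 1
  ext z
  change star (1 : ℂ) * 1 = 1
  rw [star_one, mul_one]

theorem lin_one_mul_hom (f : C(Z, ℂ)) :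
    ρ.lin (of h 1) * ρ.hom f = ρ.hom (f.comp (h : C(Z, Z))) * ρ.lin (of h 1) := by
  rw [← ρ.map_rightAct, ← ρ.map_leftAct]
  congr 1
  apply toFun_injective
  change 1 * f.comp (h : C(Z, Z)) = f.comp (h : C(Z, Z)) * 1
  rw [one_mul, mul_one]

theorem onCompacts_leftMul (g : C(Z, ℂ)) :
    ρ.onCompacts ⟨leftMul h g, leftMul_mem_compacts g⟩ =
      ρ.hom g * (ρ.lin (of h 1) * star (ρ.lin (of h 1))) := by
  change ρ.lin (leftAct g (of h 1)) * star (ρ.lin (of h 1)) = _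
  rw [ρ.map_leftAct, mul_assoc]

end Representation

namespace ToeplitzAlgebra

/-- The inclusion of `T(E)` into the direct sum of the targets of all representations. -/
def toBigSum (h : Z ≃ₜ Z) : ToeplitzAlgebra h →⋆ₙₐ[ℂ] BigSum h where
  toFun a := a.1
  map_smul' _ _ := rfl
  map_zero' := rfl
  map_add' _ _ := rfl
  map_mul' _ _ := rfl
  map_star' _ := rfl

/-- The coordinate projection of the direct sum at one representation. -/
def evalHom (ρ : RepresentationIn h) : BigSum h →⋆ₙₐ[ℂ] ρ.B where
  toFun a := a ρ
  map_smul' _ _ := rfl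
  map_zero' := rfl
  map_add' _ _ := rfl
  map_mul' _ _ := rfl
  map_star' _ := rfl

/-- The universal property of `T(E)`, for targets in any universe: the C*-algebra generated by the
given representation has a copy in the universe over which the direct sum runs, and the coordinate
projection at that copy is the required homomorphism. -/
theorem exists_lift {B : Type v} [NonUnitalCStarAlgebra B] (ρ : Representation h B) :
    ∃ Φ : ToeplitzAlgebra h →⋆ₙₐ[ℂ] B,
      (∀ x, Φ ((rep h).lin x) = ρ.lin x) ∧ ∀ g, Φ ((rep h).hom g) = ρ.hom g := by
  let e : Shrink.{u} ρ.generated ≃ ρ.generated := (equivShrink _).symm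
  let _ := CStarTransfer.nonUnitalCStarAlgebra e
  let ε : Shrink.{u} ρ.generated ≃⋆ₐ[ℂ] ρ.generated := CStarTransfer.starAlgEquiv e
  let εf : Shrink.{u} ρ.generated →⋆ₙₐ[ℂ] ρ.generated := ε
  let εb : ρ.generated →⋆ₙₐ[ℂ] Shrink.{u} ρ.generated := ε.symm
  have hε : ∀ y, εf (εb y) = y := ε.apply_symm_apply
  let r : RepresentationIn h := ⟨Shrink.{u} ρ.generated, ρ.corestrict.map εb⟩
  refine ⟨(NonUnitalStarSubalgebraClass.subtype ρ.generated).comp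
    (εf.comp ((evalHom r).comp (toBigSum h))), fun x => ?_, fun g => ?_⟩
  · exact congrArg Subtype.val (hε (ρ.corestrict.lin x))
  · exact congrArg Subtype.val (hε (ρ.corestrict.hom g))

theorem dense_adjoin (h : Z ≃ₜ Z) :
    (NonUnitalStarAlgebra.adjoin ℂ
      (Set.range (rep h).lin ∪ Set.range (rep h).hom)).topologicalClosure = ⊤ := by
  refine eq_top_iff.2 fun a _ => ?_
  have hle : NonUnitalStarAlgebra.adjoin ℂ (Set.range (bigLin h) ∪ Set.range (bigHom h)) ≤
      (NonUnitalStarAlgebra.adjoin ℂ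
        (Set.range (rep h).lin ∪ Set.range (rep h).hom)).map (toBigSum h) := by
    refine NonUnitalStarAlgebra.adjoin_le ?_
    rintro _ (⟨x, rfl⟩ | ⟨g, rfl⟩)
    · exact ⟨(rep h).lin x, NonUnitalStarAlgebra.subset_adjoin ℂ _ (Or.inl ⟨x, rfl⟩), rfl⟩
    · exact ⟨(rep h).hom g, NonUnitalStarAlgebra.subset_adjoin ℂ _ (Or.inr ⟨g, rfl⟩), rfl⟩
  exact closure_subtype.2 (closure_mono hle a.2)

end ToeplitzAlgebra

end General

/-! ### Generating pairs -/

/-- Since `X(E)` is generated by `1` as a left module, `ψ(1)` and the range of `π` generate what the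
whole representation generates. -/
theorem generates_of_dense {γ : ℝ} {B : Type v} [NonUnitalCStarAlgebra B]
    (ρ : Representation (rotation γ) B)
    (hρ : (NonUnitalStarAlgebra.adjoin ℂ
      (Set.range ρ.lin ∪ Set.range ρ.hom)).topologicalClosure = ⊤) :
    Generates ρ.hom (ρ.lin (of (rotation γ) 1)) := by
  refine eq_top_iff.2 (hρ.ge.trans (NonUnitalStarSubalgebra.topologicalClosure_mono
    (NonUnitalStarAlgebra.adjoin_le ?_)))
  rintro _ (⟨x, rfl⟩ | ⟨g, rfl⟩)
  · rw [ρ.lin_eq_hom_mul x]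
    have hx : ρ.hom x.toFun ∈ NonUnitalStarAlgebra.adjoin ℂ
        (Set.range ρ.hom ∪ {ρ.lin (of (rotation γ) 1)}) :=
      NonUnitalStarAlgebra.subset_adjoin ℂ _ (Or.inl ⟨x.toFun, rfl⟩)
    exact mul_mem hx (NonUnitalStarAlgebra.subset_adjoin ℂ _ (Or.inr rfl))
  · exact NonUnitalStarAlgebra.subset_adjoin ℂ _ (Or.inl ⟨g, rfl⟩)

theorem Generates.map {B : Type u} [NonUnitalCStarAlgebra B] {C : Type v} [NonUnitalCStarAlgebra C]
    {π : C(UnitAddCircle, ℂ) →⋆ₙₐ[ℂ] B} {S : B} (hg : Generates π S) (q : B →⋆ₙₐ[ℂ] C)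
    (hq : Function.Surjective q) : Generates (q.comp π) (q S) := by
  have hqc : Continuous q := map_continuous q
  have hle : (NonUnitalStarAlgebra.adjoin ℂ (Set.range π ∪ {S})).topologicalClosure.map q ≤
      (NonUnitalStarAlgebra.adjoin ℂ (Set.range (q.comp π) ∪ {q S})).topologicalClosure := by
    refine (NonUnitalStarSubalgebra.map_topologicalClosure_le _ hqc).trans
      (NonUnitalStarSubalgebra.topologicalClosure_mono ?_)
    refine NonUnitalStarSubalgebra.map_le.2 (NonUnitalStarAlgebra.adjoin_le ?_)
    rintro _ (⟨g, rfl⟩ | rfl)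
    · exact NonUnitalStarAlgebra.subset_adjoin ℂ _ (Or.inl ⟨g, rfl⟩)
    · exact NonUnitalStarAlgebra.subset_adjoin ℂ _ (Or.inr rfl)
  refine eq_top_iff.2 fun c _ => ?_
  obtain ⟨b, rfl⟩ := hq c
  have hb : b ∈ (NonUnitalStarAlgebra.adjoin ℂ (Set.range π ∪ {S})).topologicalClosure := by
    rw [show _ = ⊤ from hg]
    exact NonUnitalStarAlgebra.mem_top
  exact hle ⟨b, hb, rfl⟩

/-- Homomorphisms are continuous, hence determined by their values on a generating pair. -/
theorem Generates.starAlgHom_ext {B : Type u} [CStarAlgebra B] {C : Type v} [CStarAlgebra C]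
    {π : C(UnitAddCircle, ℂ) →⋆ₙₐ[ℂ] B} {S : B} (hg : Generates π S) {Φ Ψ : B →⋆ₐ[ℂ] C}
    (hπ : ∀ f, Φ (π f) = Ψ (π f)) (hS : Φ S = Ψ S) : Φ = Ψ := by
  have hcl : IsClosed {b | Φ b = Ψ b} := isClosed_eq (map_continuous Φ) (map_continuous Ψ)
  ext b
  have hb : b ∈ (NonUnitalStarAlgebra.adjoin ℂ (Set.range π ∪ {S})).topologicalClosure := by
    rw [show _ = ⊤ from hg]
    exact NonUnitalStarAlgebra.mem_top
  refine closure_minimal ?_ hcl hb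
  have hle : NonUnitalStarAlgebra.adjoin ℂ (Set.range π ∪ {S}) ≤
      NonUnitalStarAlgHom.equalizer Φ Ψ := by
    refine NonUnitalStarAlgebra.adjoin_le ?_
    rintro _ (⟨g, rfl⟩ | rfl)
    · exact hπ g
    · exact hS
  exact hle

/-! ### Toeplitz pairs and representations -/

theorem Representation.isToeplitzPair {γ : ℝ} {B : Type v} [CStarAlgebra B]
    (ρ : Representation (rotation γ) B) (h1 : ρ.hom 1 = 1) :
    IsToeplitzPair γ ρ.hom (ρ.lin (of (rotation γ) 1)) where
  map_one := h1
  isometry := ρ.star_lin_one_mul_lin_one.trans h1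
  intertwines := ρ.lin_one_mul_hom

/-- The representation `(ψ, π)` with `ψ(x) = π(x) S` attached to a Toeplitz pair `(π, S)`. -/
def IsToeplitzPair.representation {γ : ℝ} {B : Type v} [CStarAlgebra B]
    {π : C(UnitAddCircle, ℂ) →⋆ₙₐ[ℂ] B} {S : B} (hp : IsToeplitzPair γ π S) :
    Representation (rotation γ) B where
  lin :=
    { toFun := fun x => π x.toFun * S
      map_add' := fun x y => (congrArg (· * S) (map_add π x.toFun y.toFun)).trans (add_mul _ _ _)
      map_smul' := fun c x =>
        (congrArg (· * S) (map_smul π c x.toFun)).trans (smul_mul_assoc _ _ _) }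
  hom := π
  map_rightAct x g := by
    change π (x.toFun * g.comp _) * S = π x.toFun * S * π g
    rw [map_mul, mul_assoc, mul_assoc, hp.intertwines]
  star_lin_mul_lin x y := by
    change star (π x.toFun * S) * (π y.toFun * S) = π ((star x.toFun * y.toFun).comp _)
    have hcomp : ((star x.toFun * y.toFun).comp
        ((rotation γ).symm : C(UnitAddCircle, UnitAddCircle))).comp
        (rotation γ : C(UnitAddCircle, UnitAddCircle)) = star x.toFun * y.toFun := by
      ext z
      simp
    calc star (π x.toFun * S) * (π y.toFun * S)
        = star S * (π (star x.toFun * y.toFun) * S) := by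
          rw [star_mul, map_mul, map_star]
          simp only [mul_assoc]
      _ = _ := by
          conv_lhs => rw [← hcomp]
          rw [← hp.intertwines, ← mul_assoc, hp.isometry, one_mul]
  map_leftAct g x := by
    change π (g * x.toFun) * S = π g * (π x.toFun * S)
    rw [map_mul, mul_assoc]

theorem IsToeplitzPair.representation_lin_one {γ : ℝ} {B : Type v} [CStarAlgebra B]
    {π : C(UnitAddCircle, ℂ) →⋆ₙₐ[ℂ] B} {S : B} (hp : IsToeplitzPair γ π S) :
    hp.representation.lin (of (rotation γ) 1) = S := by
  change π 1 * S = S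
  rw [hp.map_one, one_mul]

theorem iHom_one (γ : ℝ) : iHom γ 1 = 1 := rfl

theorem wElt_eq (γ : ℝ) : wElt γ = GraphAlgebra.quotientMap (rotation γ) (sElt γ) := rfl

theorem isToeplitzPair_i (γ : ℝ) : IsToeplitzPair γ (iHom γ) (sElt γ) :=
  (ToeplitzAlgebra.rep (rotation γ)).isToeplitzPair (iHom_one γ)

theorem generates_i (γ : ℝ) : Generates (iHom γ) (sElt γ) :=
  generates_of_dense (ToeplitzAlgebra.rep (rotation γ)) (ToeplitzAlgebra.dense_adjoin _)

theorem IsToeplitzPair.exists_starAlgHom {γ : ℝ} {B : Type v} [CStarAlgebra B]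
    {π : C(UnitAddCircle, ℂ) →⋆ₙₐ[ℂ] B} {S : B} (hp : IsToeplitzPair γ π S) :
    ∃ Φ : ToeplitzRotation γ →⋆ₐ[ℂ] B, (∀ f, Φ (iHom γ f) = π f) ∧ Φ (sElt γ) = S := by
  obtain ⟨Φ, hlin, hhom⟩ := ToeplitzAlgebra.exists_lift hp.representation
  have h1 : Φ 1 = 1 := (hhom 1).trans hp.map_one
  refine ⟨{ Φ with
    map_one' := h1
    commutes' := fun c => ?_ }, hhom, (hlin _).trans hp.representation_lin_one⟩
  change Φ (algebraMap ℂ _ c) = algebraMap ℂ B c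
  rw [Algebra.algebraMap_eq_smul_one, map_smul, h1, Algebra.algebraMap_eq_smul_one]

/-! ### The graph algebra -/

theorem quotientMap_surjective (γ : ℝ) :
    Function.Surjective (GraphAlgebra.quotientMap (rotation γ)) :=
  Ideal.Quotient.mk_surjective

theorem ker_quotientMap (γ : ℝ) :
    RingHom.ker (GraphAlgebra.quotientMap (rotation γ)) = covarianceIdeal (rotation γ) :=
  Ideal.mk_ker

/-- The covariance relation at `g` is `i(g) (s s* - 1)`, and that at `1` is `s s* - 1` itself. -/
theorem covarianceIdeal_eq (γ : ℝ) :
    covarianceIdeal (rotation γ) =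
      CStarIdeal.closedIdeal {1 - sElt γ * star (sElt γ)} := by
  have hrel : ∀ g, (ToeplitzAlgebra.rep (rotation γ)).onCompacts
      ⟨leftMul (rotation γ) g, leftMul_mem_compacts g⟩ - (ToeplitzAlgebra.rep (rotation γ)).hom g =
        -(iHom γ g * (1 - sElt γ * star (sElt γ))) := by
    intro g
    rw [Representation.onCompacts_leftMul, mul_sub, mul_one, neg_sub]
    rfl
  refine le_antisymm (sInf_le ⟨inferInstance, CStarIdeal.isClosed_closedIdeal _, ?_⟩)
    (sInf_le ⟨inferInstance, CStarIdeal.isClosed_closedIdeal _, ?_⟩)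
  · rintro _ ⟨g, rfl⟩
    change _ - _ ∈ _
    rw [hrel]
    exact neg_mem (Ideal.mul_mem_left _ _ (CStarIdeal.subset_closedIdeal _ rfl))
  · rintro _ rfl
    have h1 := CStarIdeal.subset_closedIdeal (covarianceSet (rotation γ)) ⟨1, rfl⟩
    change _ - _ ∈ covarianceIdeal (rotation γ) at h1
    rw [hrel, iHom_one, one_mul] at h1
    exact neg_mem_iff.1 h1

theorem isCovariantPair_j (γ : ℝ) : IsCovariantPair γ (jHom γ) (wElt γ) where
  toIsToeplitzPair := (GraphAlgebra.rep (rotation γ)).isToeplitzPair rfl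
  unitary := by
    refine ⟨((GraphAlgebra.rep (rotation γ)).isToeplitzPair rfl).isometry, ?_⟩
    have h1 : 1 - sElt γ * star (sElt γ) ∈
        RingHom.ker (GraphAlgebra.quotientMap (rotation γ)) := by
      rw [ker_quotientMap, covarianceIdeal_eq]
      exact CStarIdeal.subset_closedIdeal _ rfl
    rw [RingHom.mem_ker, map_sub, map_one, map_mul, map_star, ← wElt_eq, sub_eq_zero] at h1
    exact h1.symm

theorem generates_j (γ : ℝ) : Generates (jHom γ) (wElt γ) :=
  (generates_i γ).map (GraphAlgebra.quotientMap (rotation γ)).toNonUnitalStarAlgHom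
    (quotientMap_surjective γ)

/-- The homomorphism that a covariant pair induces on `T(E_γ)` kills `1 - s s*`, hence factors
through `O(E_γ)`. -/
theorem IsCovariantPair.exists_starAlgHom {γ : ℝ} {B : Type v} [CStarAlgebra B]
    {π : C(UnitAddCircle, ℂ) →⋆ₙₐ[ℂ] B} {W : B} (hp : IsCovariantPair γ π W) :
    ∃ Φ : GraphRotation γ →⋆ₐ[ℂ] B, (∀ f, Φ (jHom γ f) = π f) ∧ Φ (wElt γ) = W := by
  obtain ⟨Φ, hπ, hW⟩ := hp.toIsToeplitzPair.exists_starAlgHom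
  have hle : covarianceIdeal (rotation γ) ≤ RingHom.ker Φ := by
    rw [covarianceIdeal_eq]
    refine sInf_le ⟨inferInstance, isClosed_eq (map_continuous Φ) continuous_const, ?_⟩
    rintro _ rfl
    change Φ _ = 0
    rw [map_sub, map_one, map_mul, map_star, hW, hp.unitary.2, sub_self]
  let Ψ : GraphRotation γ →+* B := Ideal.Quotient.lift (covarianceIdeal (rotation γ)) Φ hle
  refine ⟨{ Ψ with
    commutes' := fun c => Φ.commutes c
    map_star' := fun x => ?_ }, hπ, hW⟩
  obtain ⟨a, rfl⟩ := quotientMap_surjective γ x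
  exact map_star Φ a

end RotationGraph

end

theorem mainTheorem8 (γ : ℝ) :
    -- the Toeplitz algebra
    (RotationGraph.IsToeplitzPair γ (RotationGraph.iHom γ) (RotationGraph.sElt γ) ∧
      RotationGraph.Generates (RotationGraph.iHom γ) (RotationGraph.sElt γ) ∧
      ∀ (B : Type v) [CStarAlgebra B] (π : C(UnitAddCircle, ℂ) →⋆ₙₐ[ℂ] B) (S : B),
        RotationGraph.IsToeplitzPair γ π S →
          ∃! Φ : RotationGraph.ToeplitzRotation γ →⋆ₐ[ℂ] B,
            (∀ f, Φ (RotationGraph.iHom γ f) = π f) ∧ Φ (RotationGraph.sElt γ) = S) ∧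
    -- the graph C*-algebra
    (RotationGraph.IsCovariantPair γ (RotationGraph.jHom γ) (RotationGraph.wElt γ) ∧
      RotationGraph.Generates (RotationGraph.jHom γ) (RotationGraph.wElt γ) ∧
      ∀ (B : Type v) [CStarAlgebra B] (π : C(UnitAddCircle, ℂ) →⋆ₙₐ[ℂ] B) (W : B),
        RotationGraph.IsCovariantPair γ π W →
          ∃! Φ : RotationGraph.GraphRotation γ →⋆ₐ[ℂ] B,
            (∀ f, Φ (RotationGraph.jHom γ f) = π f) ∧ Φ (RotationGraph.wElt γ) = W) ∧
    -- the graph C*-algebra as a quotient of the Toeplitz algebra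
    (Function.Surjective (RotationGraph.GraphAlgebra.quotientMap (RotationGraph.rotation γ)) ∧
      RingHom.ker (RotationGraph.GraphAlgebra.quotientMap (RotationGraph.rotation γ)) =
        CStarIdeal.closedIdeal
          {1 - RotationGraph.sElt γ * star (RotationGraph.sElt γ)}) := by
  refine ⟨⟨RotationGraph.isToeplitzPair_i γ, RotationGraph.generates_i γ, fun B _ π S hp => ?_⟩,
    ⟨RotationGraph.isCovariantPair_j γ, RotationGraph.generates_j γ, fun B _ π W hp => ?_⟩,
    RotationGraph.quotientMap_surjective γ,
    (RotationGraph.ker_quotientMap γ).trans (RotationGraph.covarianceIdeal_eq γ)⟩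
  · obtain ⟨Φ, hπ, hS⟩ := hp.exists_starAlgHom
    exact ⟨Φ, ⟨hπ, hS⟩, fun Ψ hΨ => (RotationGraph.generates_i γ).starAlgHom_ext
      (fun f => (hΨ.1 f).trans (hπ f).symm) (hΨ.2.trans hS.symm)⟩
  · obtain ⟨Φ, hπ, hW⟩ := hp.exists_starAlgHom
    exact ⟨Φ, ⟨hπ, hW⟩, fun Ψ hΨ => (RotationGraph.generates_j γ).starAlgHom_ext
      (fun f => (hΨ.1 f).trans (hπ f).symm) (hΨ.2.trans hW.symm)⟩
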